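/- Let $n\ge 2$ and let $\Sigma^n\subset\mathbb{R}^{n+1}$ be the unit sphere with its Riemannian distance $\operatorname{dist}$ (the infimum of the lengths of curves on $\Sigma^n$ joining two points). Let $a=(a_k)_{k\in\mathbb{Z}}$ be the mask of the linear subdivision rule $(Sx)_i=\sum_{j}a_{i-2j}x_j$ given by $$(Sx)_{2i}=-\tfrac1{32}x_{i-1}+\tfrac{21}{32}x_i+\tfrac{13}{32}x_{i+1}-\tfrac1{32}x_{i+2},\qquad (Sx)_{2i+1}=-\tfrac1{32}x_{i-1}+\tfrac{13}{32}x_i+\tfrac{21}{32}x_{i+1}-\tfrac1{32}x_{i+2},$$ and let $T$ be its Riemannian analogue on $\Sigma^n$, $Tx_i=\operatorname{argmin}_{p\in\Sigma^n}\sum_{j}a_{i-2j}\operatorname{dist}(p,x_j)^2$. There are constants $\mu\in(0,1)$ and $C>0$, independent of $n$ and of the data, such that the following holds for every sequence $(x_i)_{i\in\mathbb{Z}}$ in $\Sigma^n$ with $\sup_{\ell\in\mathbb{Z}}\operatorname{dist}(x_\ell,x_{\ell+1})<0.4$. 1. (Well-definedness) All iterates $T^kx$, $k\ge0$, are well defined: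 each of the minimisation problems has exactly one global minimiser on $\Sigma^n$. 2. (Contractivity) $\operatorname{dist}(T^kx_{i+1},T^kx_i)\le\mu^k\sup_{\ell}\operatorname{dist}(x_\ell,x_{\ell+1})$ for all $k\ge0$ and $i\in\mathbb{Z}$. 3. (Displacement-safety) $\operatorname{dist}(Tx_{2i},x_i)\le C\sup_{\ell}\operatorname{dist}(x_\ell,x_{\ell+1})$ for all $i\in\mathbb{Z}$. 4. (Convergence) The data $T^kx$ converge to a continuous curve $c:\mathbb{R}\to\Sigma^n$: for every chart $\varphi:U\to\mathbb{R}^n$ (a homeomorphism from an open set $U\subset\Sigma^n$ onto an open set) and every compact $K\subset\mathbb{R}$ with $c(K)\subset U$, for all large $k$ the points $T^kx_i$ and $T^kx_{i+1}$ with $\frac{i}{2^k}\le t<\frac{i+1}{2^k}$ for some $t\in K$ lie in $U$, and the piecewise linear functions $f_k$ with $f_k(i/2^k)=\varphi(T^kx_i)$ converge to $\varphi\circ c$ uniformly on $K$. -/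

import Mathlib

open Set Filter Topology

noncomputable section

/-- The unit sphere of dimension `n` in Euclidean space of dimension `n + 1`. Its Mathlib metric is
the chordal one; the Riemannian distance is `sphereDist` below. -/
abbrev UnitSphere (n : ℕ) : Type :=
  Metric.sphere (0 : EuclideanSpace ℝ (Fin (n + 1))) 1

/-- Riemannian distance on the unit sphere: the infimum of the lengths of the continuously
differentiable curves on the sphere, parametrised over `[0,1]`, that join `p` to `q`. -/
def sphereDist {n : ℕ} (p q : UnitSphere n) : ℝ :=
  sInf {L : ℝ | ∃ γ : ℝ → EuclideanSpace ℝ (Fin (n + 1)),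
    ContDiffOn ℝ 1 γ (Icc 0 1) ∧
    (∀ t ∈ Icc (0 : ℝ) 1, γ t ∈ Metric.sphere (0 : EuclideanSpace ℝ (Fin (n + 1))) 1) ∧
    γ 0 = p ∧ γ 1 = q ∧
    L = ∫ t in (0 : ℝ)..1, ‖deriv γ t‖}

/-- The largest distance of consecutive points of a sequence on the sphere. -/
def maxStep {n : ℕ} (x : ℤ → UnitSphere n) : ℝ :=
  ⨆ l : ℤ, sphereDist (x l) (x (l + 1))

/-- The function `p ↦ ∑ j, a (i - 2 j) dist(p, x j)²` whose minimiser is the `i`-th refined point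
of the data `x`, for a finitely supported mask `a`. -/
def centerEnergy {n : ℕ} (a : ℤ → ℝ) (x : ℤ → UnitSphere n) (i : ℤ) (p : UnitSphere n) : ℝ :=
  ∑ᶠ j : ℤ, a (i - 2 * j) * sphereDist p (x j) ^ 2

/-- `p` is a (global) minimiser of `centerEnergy a x i`. -/
def IsCenter {n : ℕ} (a : ℤ → ℝ) (x : ℤ → UnitSphere n) (i : ℤ) (p : UnitSphere n) : Prop :=
  ∀ q : UnitSphere n, centerEnergy a x i p ≤ centerEnergy a x i q

open Classical in
/-- The Riemannian analogue of the linear subdivision rule `(S x) i = ∑ j, a (i - 2 j) x j`: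
the `i`-th new point is the minimiser of `centerEnergy a x i` (some minimiser if there are several,
and the irrelevant value `x i` if there is none). -/
def riemannianAnalogue {n : ℕ} (a : ℤ → ℝ) (x : ℤ → UnitSphere n) : ℤ → UnitSphere n :=
  fun i => if h : ∃ p, IsCenter a x i p then h.choose else x i

/-- The mask `a` with
`(S x) (2 i)     = -1/32 x (i-1) + 21/32 x i + 13/32 x (i+1) - 1/32 x (i+2)` and
`(S x) (2 i + 1) = -1/32 x (i-1) + 13/32 x i + 21/32 x (i+1) - 1/32 x (i+2)`,
where `(S x) i = ∑ j, a (i - 2 j) x j`. -/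
def negMask (k : ℤ) : ℝ :=
  if k = -4 ∨ k = -3 ∨ k = 2 ∨ k = 3 then -1 / 32
  else if k = -1 ∨ k = 0 then 21 / 32
  else if k = -2 ∨ k = 1 then 13 / 32
  else 0

/-- The piecewise linear function on the real line, with nodes `i / 2 ^ k`, that has the value `y i`
at `i / 2 ^ k`. -/
def dyadicInterp {V : Type*} [AddCommGroup V] [Module ℝ V] (k : ℕ) (y : ℤ → V) (t : ℝ) : V :=
  (1 - Int.fract (2 ^ k * t)) • y ⌊(2 : ℝ) ^ k * t⌋ +
    Int.fract ((2 : ℝ) ^ k * t) • y (⌊(2 : ℝ) ^ k * t⌋ + 1)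

/-- The refined data `P 0, P 1, P 2, …` converge to the curve `c`: in every coordinate chart `φ` and
on every compact set `K` of parameters which `c` maps into the domain of `φ`, the points of `P k`
that belong to parameters in `K` finally lie in the domain of `φ`, and their piecewise linear
interpolants in the chart converge to `φ ∘ c` uniformly on `K`. -/
def ConvergesToCurve {n : ℕ} (P : ℕ → ℤ → UnitSphere n) (c : ℝ → UnitSphere n) : Prop :=
  ∀ φ : OpenPartialHomeomorph (UnitSphere n) (EuclideanSpace ℝ (Fin n)),
    ∀ K : Set ℝ, IsCompact K → MapsTo c K φ.source →
      (∀ᶠ k : ℕ in atTop, ∀ t ∈ K, P k ⌊(2 : ℝ) ^ k * t⌋ ∈ φ.source ∧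
        P k (⌊(2 : ℝ) ^ k * t⌋ + 1) ∈ φ.source) ∧
      TendstoUniformlyOn (fun k : ℕ => dyadicInterp k (fun i => φ (P k i))) (fun t => φ (c t))
        atTop K

end

/-! The Riemannian distance on the sphere is the angle between unit vectors, so each new point
minimises an energy of squared angles to four consecutive data points, with weights 21, 13, -1, -1
up to a factor. Odd positions give the same problem with the four points reversed. Everything rests
on two comparisons of the spherical law of cosines with the Euclidean one: `sq_le_of_spherical_cos`
bounds a squared side above by the Euclidean value, and `le_sq_of_spherical_cos` bounds it below
with a controlled loss in one quadratic term. Both come from convexity of `cos √z`. They replace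
Hessian estimates and treat the negative weights, where the two bounds exchange roles.

Comparing energies with the data point of weight 21 localises every minimiser
(`IsFourPointMin.angle_le`). There its gradient vanishes, and the energy is strongly convex at the
relevant scale (`fourPointEnergy_add_le`), which gives uniqueness; existence is compactness.

Contractivity has two cases. The two points inserted near one edge minimise energies whose gradients
differ by a small vector, so strong convexity keeps them within `0.98 * d`
(`IsFourPointMin.angle_reverse_le`). Across a data point the triangle inequality is used, which
needs displacement strictly below half a step; the sharper `IsFourPointMin.angle_le_half` gives
`0.49 * d`. Hence the factor is 0.98 and the displacement constant 0.49. Convergence then follows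
from geometric decay. -/

/-! ### Scalar comparison of spherical and Euclidean triangles -/

lemma mul_sin_le_mul_sin {x y : ℝ} (hx : 0 ≤ x) (hxy : x ≤ y) (hy : y ≤ Real.pi) :
    x * Real.sin y ≤ y * Real.sin x := by
  rcases hx.eq_or_lt with rfl | hx
  · simp
  have hy0 : 0 < y := hx.trans_le hxy
  have h := strictConcaveOn_sin_Icc.concaveOn.2 (⟨le_rfl, Real.pi_pos.le⟩ : (0 : ℝ) ∈ Icc 0 Real.pi)
    (⟨hy0.le, hy⟩ : y ∈ Icc 0 Real.pi)
    (sub_nonneg.2 ((div_le_one hy0).2 hxy)) (show 0 ≤ x / y by positivity) (by ring)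
  simp only [smul_eq_mul, mul_zero, Real.sin_zero, zero_add] at h
  rw [div_mul_cancel₀ _ hy0.ne', div_mul_eq_mul_div, div_le_iff₀ hy0] at h
  linarith

/-- The tangent line inequality for the convex function `z ↦ cos √z`. -/
lemma cos_sqrt_tangent {m c : ℝ} (hm : 0 ≤ m) (hmπ : m ≤ Real.pi) (hc : 0 ≤ c)
    (hcπ : c ≤ Real.pi) :
    2 * m * Real.cos m + Real.sin m * m ^ 2 ≤ 2 * m * Real.cos c + Real.sin m * c ^ 2 := by
  set φ : ℝ → ℝ := fun c => 2 * m * Real.cos c + Real.sin m * c ^ 2 with hφ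
  have hd : ∀ c, HasDerivAt φ (2 * (c * Real.sin m - m * Real.sin c)) c := fun c => by
    have h := ((Real.hasDerivAt_cos c).const_mul (2 * m)).add
      ((hasDerivAt_pow 2 c).const_mul (Real.sin m))
    refine h.congr_deriv ?_
    push_cast
    ring
  have hcont : Continuous φ := by fun_prop
  have hdiff : Differentiable ℝ φ := fun c => (hd c).differentiableAt
  change φ m ≤ φ c
  rcases le_total c m with h | h
  · refine antitoneOn_of_deriv_nonpos (convex_Icc 0 m) hcont.continuousOn
      hdiff.differentiableOn (fun z hz => ?_) ⟨hc, h⟩ ⟨hm, le_rfl⟩ h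
    rw [interior_Icc] at hz
    rw [(hd z).deriv]
    linarith [mul_sin_le_mul_sin hz.1.le hz.2.le hmπ]
  · refine monotoneOn_of_deriv_nonneg (convex_Icc m Real.pi) hcont.continuousOn
      hdiff.differentiableOn (fun z hz => ?_) ⟨le_rfl, hmπ⟩ ⟨h, hcπ⟩ h
    rw [interior_Icc] at hz
    rw [(hd z).deriv]
    linarith [mul_sin_le_mul_sin hm hz.1.le hz.2.le]

/-- A spherical triangle has a shorter third side than the Euclidean one with the same two sides
and enclosed angle. -/
lemma sq_le_of_spherical_cos {a b c y : ℝ} (ha : 0 ≤ a) (hb : 0 ≤ b) (hab : a + b ≤ Real.pi)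
    (hc : 0 ≤ c) (hcπ : c ≤ Real.pi) (hy1 : -1 ≤ y) (hy2 : y ≤ 1)
    (h : Real.cos c = Real.cos a * Real.cos b + Real.sin a * Real.sin b * y) :
    c ^ 2 ≤ a ^ 2 + b ^ 2 - 2 * a * b * y := by
  have hab0 : 0 ≤ a * b := mul_nonneg ha hb
  have hz : 0 ≤ a ^ 2 + b ^ 2 - 2 * a * b * y := by nlinarith [sq_nonneg (a - b)]
  set m := Real.sqrt (a ^ 2 + b ^ 2 - 2 * a * b * y) with hmdef
  have hm2 : m ^ 2 = a ^ 2 + b ^ 2 - 2 * a * b * y := Real.sq_sqrt hz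
  have hm : 0 ≤ m := Real.sqrt_nonneg _
  have hmab : m ≤ a + b := by
    apply Real.sqrt_le_iff.2 ⟨by positivity, ?_⟩
    nlinarith
  have key : Real.cos m ≤ Real.cos c := by
    rcases hm.eq_or_lt with h0 | h0
    · rw [← h0] at hm2
      have e1 : (a - b) ^ 2 = 0 := by nlinarith [sq_nonneg (a - b)]
      have e2 : a = b := by nlinarith [pow_eq_zero_iff (two_ne_zero) |>.1 e1]
      subst e2
      have e3 : a * a * (1 - y) = 0 := by nlinarith
      rw [← h0, h, Real.cos_zero]
      rcases mul_eq_zero.1 e3 with e | e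
      · have : a = 0 := by simpa using e
        simp [this]
      · have : y = 1 := by linarith
        rw [this]
        nlinarith [Real.sin_sq_add_cos_sq a]
    -- Jensen: with weights `(1 + y) / 2` and `(1 - y) / 2`, `cos c` averages `cos (a - b)` and `cos
    -- (a + b)`, while `m ^ 2` averages `(a - b) ^ 2` and `(a + b) ^ 2`.
    · have t1 := cos_sqrt_tangent hm (hmab.trans hab) (abs_nonneg (a - b))
        (abs_le.2 ⟨by linarith, by linarith⟩)
      have t2 := cos_sqrt_tangent hm (hmab.trans hab) (add_nonneg ha hb) hab
      rw [Real.cos_abs, sq_abs, Real.cos_sub] at t1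
      rw [Real.cos_add] at t2
      have t3 := mul_le_mul_of_nonneg_left t1 (show 0 ≤ (1 + y) / 2 by linarith)
      have t4 := mul_le_mul_of_nonneg_left t2 (show 0 ≤ (1 - y) / 2 by linarith)
      rw [h]
      have t5 : 2 * m * Real.cos m ≤
          2 * m * (Real.cos a * Real.cos b + Real.sin a * Real.sin b * y) := by
        rw [hm2] at t3 t4
        linarith
      exact le_of_mul_le_mul_left t5 (by positivity)
  have hcm : c ≤ m := by
    by_contra hlt
    push Not at hlt
    exact absurd (Real.cos_lt_cos_of_nonneg_of_le_pi hm hcπ hlt) (not_lt.2 key)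
  rw [← hm2]
  exact pow_le_pow_left₀ hc hcm 2

/-- The tangent inequality at `m = a` gives a lower bound in terms of `sin b` and `1 - cos b`. In
the coefficient of `b ^ 2`, the factors `1 - A ^ 2 / 2` and `1 - 5 / 48 * B ^ 2` come from `cos a`
and `2 * (1 - cos b)`, and `A * B / 3` pays for replacing `sin b` by `b`. -/
lemma le_sq_of_spherical_cos {a b c y A B : ℝ} (ha : 0 ≤ a) (hb : 0 ≤ b) (haA : a ≤ A)
    (hbB : b ≤ B) (hA : A ≤ 1) (hB : B ≤ 1)
    (hc : 0 ≤ c) (hcπ : c ≤ Real.pi) (hy1 : -1 ≤ y)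
    (h : Real.cos c = Real.cos a * Real.cos b + Real.sin a * Real.sin b * y) :
    a ^ 2 + ((1 - A ^ 2 / 2) * (1 - 5 / 48 * B ^ 2) - A * B / 3) * b ^ 2 - 2 * a * b * y
      ≤ c ^ 2 := by
  have hπ := Real.pi_gt_three
  have hb1 : b ≤ 1 := hbB.trans hB
  have hcosb : b ^ 2 * (1 - 5 / 48 * B ^ 2) ≤ 2 * (1 - Real.cos b) := by
    have h1 := Real.cos_bound (x := b) (by rwa [abs_of_nonneg hb])
    rw [abs_of_nonneg hb] at h1
    have h2 := (abs_le.1 h1).2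
    have h3 : b ^ 2 ≤ B ^ 2 := pow_le_pow_left₀ hb hbB 2
    nlinarith [mul_le_mul_of_nonneg_left h3 (sq_nonneg b)]
  have hsinb := Real.sin_ge_sub_cube hb
  have hsinb' := Real.sin_le hb
  have hcosa : 1 - A ^ 2 / 2 ≤ Real.cos a := by
    have h3 : a ^ 2 ≤ A ^ 2 := pow_le_pow_left₀ ha haA 2
    linarith [Real.one_sub_sq_div_two_le_cos (x := a)]
  have hA0 : 0 ≤ 1 - A ^ 2 / 2 := by nlinarith
  have hB0 : 0 ≤ 1 - 5 / 48 * B ^ 2 := by nlinarith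
  have hcosb0 : 0 ≤ 2 * (1 - Real.cos b) := by linarith [Real.cos_le_one b]
  have main : a ^ 2 - 2 * a * y * Real.sin b + Real.cos a * (2 * (1 - Real.cos b)) ≤ c ^ 2 := by
    rcases ha.eq_or_lt with rfl | ha0
    · simp only [Real.cos_zero, Real.sin_zero] at h ⊢
      have := Real.one_sub_sq_div_two_le_cos (x := c)
      linarith
    · have hs : 0 < Real.sin a := Real.sin_pos_of_pos_of_lt_pi ha0 (by linarith)
      have t := cos_sqrt_tangent ha (by linarith) hc hcπ
      rw [h] at t
      have hsa := Real.sin_le ha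
      have e : Real.sin a * (a ^ 2 - 2 * a * y * Real.sin b + Real.cos a * (2 * (1 - Real.cos b)))
          ≤ Real.sin a * c ^ 2 := by
        have e1 : Real.sin a * (Real.cos a * (2 * (1 - Real.cos b))) ≤
            a * (Real.cos a * (2 * (1 - Real.cos b))) :=
          mul_le_mul_of_nonneg_right hsa (mul_nonneg (hA0.trans hcosa) hcosb0)
        linarith
      exact le_of_mul_le_mul_left e hs
  have k1 : (1 - A ^ 2 / 2) * (b ^ 2 * (1 - 5 / 48 * B ^ 2)) ≤
      Real.cos a * (2 * (1 - Real.cos b)) :=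
    mul_le_mul hcosa hcosb (by positivity) (hA0.trans hcosa)
  have k2 : -(2 * a * (b ^ 3 / 6)) ≤ 2 * a * (y * (b - Real.sin b)) := by
    have : -(b ^ 3 / 6) ≤ y * (b - Real.sin b) := by
      have : -(b - Real.sin b) ≤ y * (b - Real.sin b) := by
        nlinarith
      linarith
    nlinarith
  have k3 : 2 * a * (b ^ 3 / 6) ≤ A * B / 3 * b ^ 2 := by
    have : a * b ≤ A * B := mul_le_mul haA hbB hb (ha.trans haA)
    nlinarith [mul_le_mul_of_nonneg_right this (sq_nonneg b)]
  linarith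

/-! ### Logarithm map and law of cosines on the unit sphere -/

section

open InnerProductGeometry
open scoped RealInnerProductSpace

variable {V : Type*} [NormedAddCommGroup V] [InnerProductSpace ℝ V]

/-- The inverse `o ↦ exp_o⁻¹ x` of the exponential map of the unit sphere, for `x ≠ -o`. -/
noncomputable def sphereLog (o x : V) : V :=
  (angle o x / Real.sin (angle o x)) • (x - Real.cos (angle o x) • o)

lemma inner_eq_cos_angle_of_unit {o x : V} (ho : ‖o‖ = 1) (hx : ‖x‖ = 1) :
    ⟪o, x⟫ = Real.cos (angle o x) := by
  rw [← cos_angle_mul_norm_mul_norm, ho, hx]; ring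

lemma eq_of_angle_eq_zero_of_unit {o x : V} (ho : ‖o‖ = 1) (hx : ‖x‖ = 1) (h : angle o x = 0) :
    o = x := by
  have := inner_eq_cos_angle_of_unit ho hx
  rw [h, Real.cos_zero] at this
  exact (inner_eq_one_iff_of_norm_eq_one ho hx).1 this

lemma angle_self_of_unit {o : V} (ho : ‖o‖ = 1) : angle o o = 0 :=
  angle_self (by rintro rfl; simp at ho)

lemma inner_sphereLog_left_self {o x : V} (ho : ‖o‖ = 1) (hx : ‖x‖ = 1) :
    ⟪o, sphereLog o x⟫ = 0 := by
  rw [sphereLog, inner_smul_right, inner_sub_right, inner_smul_right,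
    inner_eq_cos_angle_of_unit ho hx, real_inner_self_eq_norm_sq, ho]
  ring

lemma inner_sub_smul_sub_smul {o x q : V} (ho : ‖o‖ = 1) (hx : ‖x‖ = 1) (hq : ‖q‖ = 1) :
    ⟪x - Real.cos (angle o x) • o, q - Real.cos (angle o q) • o⟫ =
      Real.cos (angle x q) - Real.cos (angle o x) * Real.cos (angle o q) := by
  rw [inner_sub_left, inner_sub_right, inner_sub_right, inner_smul_left, inner_smul_left,
    inner_smul_right, inner_smul_right, real_inner_comm o x, inner_eq_cos_angle_of_unit hx hq,
    inner_eq_cos_angle_of_unit ho hx, inner_eq_cos_angle_of_unit ho hq,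
    real_inner_self_eq_norm_sq, ho]
  simp [mul_comm]

lemma norm_sub_smul_cos_angle {o x : V} (ho : ‖o‖ = 1) (hx : ‖x‖ = 1) :
    ‖x - Real.cos (angle o x) • o‖ = Real.sin (angle o x) := by
  rw [← sq_eq_sq₀ (norm_nonneg _) (sin_angle_nonneg _ _), ← real_inner_self_eq_norm_sq,
    inner_sub_smul_sub_smul ho hx hx, angle_self_of_unit hx, Real.cos_zero]
  nlinarith [Real.sin_sq_add_cos_sq (angle o x)]

lemma eq_of_angle_sin_eq_zero {o x : V} (h : angle o x < Real.pi)
    (hs : Real.sin (angle o x) = 0) : angle o x = 0 := by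
  by_contra hne
  exact (Real.sin_pos_of_pos_of_lt_pi ((angle_nonneg o x).lt_of_ne' hne) h).ne' hs

lemma norm_sphereLog {o x : V} (ho : ‖o‖ = 1) (hx : ‖x‖ = 1) (h : angle o x < Real.pi) :
    ‖sphereLog o x‖ = angle o x := by
  rw [sphereLog, norm_smul, norm_sub_smul_cos_angle ho hx, Real.norm_eq_abs,
    abs_of_nonneg (div_nonneg (angle_nonneg _ _) (sin_angle_nonneg _ _))]
  rcases eq_or_ne (Real.sin (angle o x)) 0 with hs | hs
  · rw [hs, eq_of_angle_sin_eq_zero h hs]; simp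
  · rw [div_mul_cancel₀ _ hs]

/-- The spherical law of cosines, with `y` the cosine of the angle at `o`. -/
lemma exists_cos_enclosed_angle {o x q : V} (ho : ‖o‖ = 1) (hx : ‖x‖ = 1) (hq : ‖q‖ = 1) :
    ∃ y : ℝ, -1 ≤ y ∧ y ≤ 1 ∧ ⟪sphereLog o x, sphereLog o q⟫ = angle o x * angle o q * y ∧
      Real.cos (angle q x) = Real.cos (angle o x) * Real.cos (angle o q) +
        Real.sin (angle o x) * Real.sin (angle o q) * y := by
  have hin := inner_sub_smul_sub_smul ho hx hq
  have habs := abs_real_inner_le_norm (x - Real.cos (angle o x) • o) (q - Real.cos (angle o q) • o)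
  rw [norm_sub_smul_cos_angle ho hx, norm_sub_smul_cos_angle ho hq] at habs
  set s := Real.sin (angle o x) with hs
  set t := Real.sin (angle o q) with ht
  set I := ⟪x - Real.cos (angle o x) • o, q - Real.cos (angle o q) • o⟫ with hI
  have hs0 : 0 ≤ s := sin_angle_nonneg _ _
  have ht0 : 0 ≤ t := sin_angle_nonneg _ _
  have hst : 0 ≤ s * t := mul_nonneg hs0 ht0
  have hlog : ⟪sphereLog o x, sphereLog o q⟫ = (angle o x / s) * ((angle o q / t) * I) := by
    rw [sphereLog, sphereLog, real_inner_smul_left, real_inner_smul_right]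
  refine ⟨I / (s * t), ?_, ?_, ?_, ?_⟩
  · exact (abs_le.1 (by rw [abs_div, abs_of_nonneg hst]; exact div_le_one_of_le₀ habs hst)).1
  · exact (abs_le.1 (by rw [abs_div, abs_of_nonneg hst]; exact div_le_one_of_le₀ habs hst)).2
  · rw [hlog]; ring
  · rw [angle_comm q x]
    rcases eq_or_ne (s * t) 0 with h0 | h0
    · rw [h0, abs_le] at habs
      rw [h0]
      linarith [habs.1, habs.2]
    · rw [mul_div_cancel₀ _ h0]
      linarith

lemma angle_sq_le_add_sub_inner {o x q : V} (ho : ‖o‖ = 1) (hx : ‖x‖ = 1) (hq : ‖q‖ = 1)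
    (h : angle o x + angle o q ≤ Real.pi) :
    angle q x ^ 2 ≤ angle o x ^ 2 + angle o q ^ 2 - 2 * ⟪sphereLog o x, sphereLog o q⟫ := by
  obtain ⟨y, hy1, hy2, e1, e2⟩ := exists_cos_enclosed_angle ho hx hq
  rw [e1]
  linarith [sq_le_of_spherical_cos (angle_nonneg o x) (angle_nonneg o q) h (angle_nonneg q x)
    (angle_le_pi q x) hy1 hy2 e2]

lemma add_sub_inner_le_angle_sq {o x q : V} (ho : ‖o‖ = 1) (hx : ‖x‖ = 1) (hq : ‖q‖ = 1)
    {A B : ℝ} (hA : angle o x ≤ A) (hB : angle o q ≤ B) (hA1 : A ≤ 1) (hB1 : B ≤ 1) :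
    angle o x ^ 2 + ((1 - A ^ 2 / 2) * (1 - 5 / 48 * B ^ 2) - A * B / 3) * angle o q ^ 2
      - 2 * ⟪sphereLog o x, sphereLog o q⟫ ≤ angle q x ^ 2 := by
  obtain ⟨y, hy1, -, e1, e2⟩ := exists_cos_enclosed_angle ho hx hq
  rw [e1]
  linarith [le_sq_of_spherical_cos (angle_nonneg o x) (angle_nonneg o q) hA hB hA1 hB1
    (angle_nonneg q x) (angle_le_pi q x) hy1 e2]

lemma norm_sub_le_angle {o x : V} (ho : ‖o‖ = 1) (hx : ‖x‖ = 1) : ‖o - x‖ ≤ angle o x := by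
  rw [← sq_le_sq₀ (norm_nonneg _) (angle_nonneg _ _), norm_sub_sq_real,
    inner_eq_cos_angle_of_unit ho hx, ho, hx]
  linarith [Real.one_sub_sq_div_two_le_cos (x := angle o x)]

/-- The logarithm does not expand distances much. -/
lemma norm_sphereLog_sub_le {o x q : V} (ho : ‖o‖ = 1) (hx : ‖x‖ = 1) (hq : ‖q‖ = 1)
    {d : ℝ} (hox : angle o x ≤ d) (hoq : angle o q ≤ 2 * d) (hd : d ≤ 0.4) (hxq : angle x q ≤ d) :
    ‖sphereLog o q - sphereLog o x‖ ≤ 1.4 * d := by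
  have hd0 : 0 ≤ d := (angle_nonneg o x).trans hox
  -- The left side is the projection of the chord orthogonally to `o`, and projecting does not
  -- increase length.
  have hchord : ‖(q - Real.cos (angle o q) • o) - (x - Real.cos (angle o x) • o)‖ ≤ d := by
    refine le_trans ?_ ((norm_sub_le_angle hx hq).trans hxq)
    have e : (q - Real.cos (angle o q) • o) - (x - Real.cos (angle o x) • o) =
        (q - x) - ⟪o, q - x⟫ • o := by
      rw [inner_sub_right, inner_eq_cos_angle_of_unit ho hx, inner_eq_cos_angle_of_unit ho hq]
      module
    rw [e, norm_sub_rev x q, ← sq_le_sq₀ (norm_nonneg _) (norm_nonneg _), norm_sub_sq_real,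
      real_inner_smul_right, norm_smul, ho, real_inner_comm, Real.norm_eq_abs, mul_one, sq_abs]
    nlinarith [sq_nonneg ⟪o, q - x⟫]
  -- The logarithm rescales this projection by a factor between 1 and 1.2, so rescaling costs `1.2 *
  -- d` and the variation of the factor `0.2 * d`.
  have hfac : ∀ z : V, angle o z ≤ 0.8 → angle o z ≠ 0 →
      1 ≤ angle o z / Real.sin (angle o z) ∧ angle o z / Real.sin (angle o z) ≤ 1.2 := by
    intro z hz hz0
    have hp : 0 < angle o z := (angle_nonneg o z).lt_of_ne' hz0
    have hs : 0 < Real.sin (angle o z) :=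
      Real.sin_pos_of_pos_of_lt_pi hp (by linarith [Real.pi_gt_three])
    rw [le_div_iff₀ hs, div_le_iff₀ hs]
    refine ⟨by linarith [Real.sin_le hp.le], ?_⟩
    have := Real.sin_gt_sub_cube hp
    have h2 : angle o z ^ 2 ≤ 0.8 ^ 2 := pow_le_pow_left₀ hp.le hz 2
    nlinarith
  have hπ := Real.pi_gt_three
  by_cases hx0 : angle o x = 0
  · have hx1 := eq_of_angle_eq_zero_of_unit ho hx hx0
    subst hx1
    have : sphereLog o o = 0 := by simp [sphereLog, hx0]
    rw [this, sub_zero, norm_sphereLog ho hq (by linarith)]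
    linarith
  by_cases hq0 : angle o q = 0
  · have : sphereLog o q = 0 := by simp [sphereLog, hq0]
    rw [this, zero_sub, norm_neg, norm_sphereLog ho hx (by linarith)]
    linarith
  obtain ⟨a1, a2⟩ := hfac x (by linarith) hx0
  obtain ⟨b1, b2⟩ := hfac q (by linarith) hq0
  set α := angle o x / Real.sin (angle o x) with hα
  set β := angle o q / Real.sin (angle o q) with hβ
  have e : sphereLog o q - sphereLog o x =
      β • ((q - Real.cos (angle o q) • o) - (x - Real.cos (angle o x) • o)) +
        (β - α) • (x - Real.cos (angle o x) • o) := by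
    rw [sphereLog, sphereLog]
    module
  rw [e]
  refine (norm_add_le _ _).trans ?_
  rw [norm_smul, norm_smul, norm_sub_smul_cos_angle ho hx, Real.norm_eq_abs, Real.norm_eq_abs,
    abs_of_nonneg (by linarith : 0 ≤ β)]
  have h1 : β * ‖(q - Real.cos (angle o q) • o) - (x - Real.cos (angle o x) • o)‖ ≤ 1.2 * d :=
    mul_le_mul b2 hchord (norm_nonneg _) (by norm_num)
  have h2 : |β - α| * Real.sin (angle o x) ≤ 0.2 * d :=
    mul_le_mul (abs_le.2 ⟨by linarith, by linarith⟩)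
      ((Real.sin_le (angle_nonneg _ _)).trans hox) (sin_angle_nonneg _ _) (by norm_num)
  linarith

lemma unit_cos_smul_add_sin_smul {o u : V} (ho : ‖o‖ = 1) (hu : ‖u‖ = 1) (hou : ⟪o, u⟫ = 0)
    (s : ℝ) : ‖Real.cos s • o + Real.sin s • u‖ = 1 := by
  rw [← sq_eq_sq₀ (norm_nonneg _) zero_le_one, norm_add_sq_real, norm_smul, norm_smul,
    real_inner_smul_left, real_inner_smul_right, hou, ho, hu]
  simp [Real.cos_sq_add_sin_sq]

lemma angle_cos_smul_add_sin_smul {o u : V} (ho : ‖o‖ = 1) (hu : ‖u‖ = 1) (hou : ⟪o, u⟫ = 0)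
    {s : ℝ} (hs : 0 ≤ s) (hsπ : s ≤ Real.pi) :
    angle o (Real.cos s • o + Real.sin s • u) = s := by
  have h := inner_eq_cos_angle_of_unit ho (unit_cos_smul_add_sin_smul ho hu hou s)
  rw [inner_add_right, real_inner_smul_right, real_inner_smul_right, hou,
    real_inner_self_eq_norm_sq, ho, one_pow, mul_one, mul_zero, add_zero] at h
  exact (Real.injOn_cos ⟨hs, hsπ⟩ ⟨angle_nonneg _ _, angle_le_pi _ _⟩ h).symm

lemma sphereLog_cos_smul_add_sin_smul {o u : V} (ho : ‖o‖ = 1) (hu : ‖u‖ = 1) (hou : ⟪o, u⟫ = 0)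
    {s : ℝ} (hs : 0 < s) (hsπ : s < Real.pi) :
    sphereLog o (Real.cos s • o + Real.sin s • u) = s • u := by
  rw [sphereLog, angle_cos_smul_add_sin_smul ho hu hou hs.le hsπ.le, add_sub_cancel_left, smul_smul,
    div_mul_cancel₀ _ (Real.sin_pos_of_pos_of_lt_pi hs hsπ).ne']

end

/-! ### Minimisers of the four-point energy -/

section

open InnerProductGeometry
open scoped RealInnerProductSpace

variable {V : Type*} [NormedAddCommGroup V] [InnerProductSpace ℝ V]

/-- Four unit vectors with consecutive angles at most `d ≤ 0.4`. -/
structure IsSphereChain (d : ℝ) (y₀ y₁ y₂ y₃ : V) : Prop where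
  d_le : d ≤ 0.4
  n₀ : ‖y₀‖ = 1
  n₁ : ‖y₁‖ = 1
  n₂ : ‖y₂‖ = 1
  n₃ : ‖y₃‖ = 1
  h₀₁ : angle y₀ y₁ ≤ d
  h₁₂ : angle y₁ y₂ ≤ d
  h₂₃ : angle y₂ y₃ ≤ d

/-- The energy whose minimiser is the Riemannian average of `y₀, y₁, y₂, y₃` with the weights
`-1/32, 21/32, 13/32, -1/32`, multiplied by `32`. -/
noncomputable def fourPointEnergy (y₀ y₁ y₂ y₃ p : V) : ℝ :=
  21 * angle p y₁ ^ 2 + 13 * angle p y₂ ^ 2 - angle p y₀ ^ 2 - angle p y₃ ^ 2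

/-- Up to the factor `-2`, the Riemannian gradient of `fourPointEnergy y₀ y₁ y₂ y₃` at `p`. -/
noncomputable def fourPointGrad (y₀ y₁ y₂ y₃ p : V) : V :=
  (21 : ℝ) • sphereLog p y₁ + (13 : ℝ) • sphereLog p y₂ - sphereLog p y₀ - sphereLog p y₃

/-- `q` minimises `fourPointEnergy y₀ y₁ y₂ y₃` over the unit sphere. -/
structure IsFourPointMin (y₀ y₁ y₂ y₃ q : V) : Prop where
  norm_eq : ‖q‖ = 1
  le : ∀ r : V, ‖r‖ = 1 → fourPointEnergy y₀ y₁ y₂ y₃ q ≤ fourPointEnergy y₀ y₁ y₂ y₃ r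

variable {d : ℝ} {y₀ y₁ y₂ y₃ p q : V}

lemma IsSphereChain.symm (h : IsSphereChain d y₀ y₁ y₂ y₃) : IsSphereChain d y₃ y₂ y₁ y₀ where
  d_le := h.d_le
  n₀ := h.n₃
  n₁ := h.n₂
  n₂ := h.n₁
  n₃ := h.n₀
  h₀₁ := by rw [angle_comm]; exact h.h₂₃
  h₁₂ := by rw [angle_comm]; exact h.h₁₂
  h₂₃ := by rw [angle_comm]; exact h.h₀₁

lemma IsSphereChain.nonneg (h : IsSphereChain d y₀ y₁ y₂ y₃) : 0 ≤ d :=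
  (angle_nonneg _ _).trans h.h₀₁

/-- The competitor `y₁` has energy at most `13 * d ^ 2`. The triangle inequality bounds the two
negatively weighted terms, leaving a quadratic inequality in the distances to `y₁` and `y₂`. -/
lemma IsFourPointMin.angle_le (hq : IsFourPointMin y₀ y₁ y₂ y₃ q)
    (h : IsSphereChain d y₀ y₁ y₂ y₃) :
    angle q y₁ ≤ 0.93 * d ∧ angle q y₂ ≤ 1.21 * d ∧ angle q y₀ ≤ 1.93 * d ∧
      angle q y₃ ≤ 2.21 * d := by
  have hd := h.nonneg
  have h0 := angle_le_angle_add_angle q y₁ y₀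
  have h3 := angle_le_angle_add_angle q y₂ y₃
  have e := hq.le y₁ h.n₁
  rw [angle_comm y₁ y₀] at h0
  rw [fourPointEnergy, fourPointEnergy, angle_self_of_unit h.n₁] at e
  have h01 := h.h₀₁
  have h12 := h.h₁₂
  have h23 := h.h₂₃
  have g0 : angle q y₀ ^ 2 ≤ (angle q y₁ + d) ^ 2 :=
    pow_le_pow_left₀ (angle_nonneg _ _) (by linarith) 2
  have g3 : angle q y₃ ^ 2 ≤ (angle q y₂ + d) ^ 2 :=
    pow_le_pow_left₀ (angle_nonneg _ _) (by linarith) 2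
  have g12 : angle y₁ y₂ ^ 2 ≤ d ^ 2 := pow_le_pow_left₀ (angle_nonneg _ _) h12 2
  have p1 := angle_nonneg q y₁
  have p2 := angle_nonneg q y₂
  have key : 20 * angle q y₁ ^ 2 - 2 * d * angle q y₁ + 12 * angle q y₂ ^ 2 - 2 * d * angle q y₂
      ≤ 15 * d ^ 2 := by
    nlinarith [sq_nonneg (angle y₁ y₀), sq_nonneg (angle y₁ y₃)]
  -- Completing the square in the other distance isolates one unknown.
  have b1 : angle q y₁ ≤ 0.93 * d := by
    by_contra hc
    push Not at hc
    nlinarith [sq_nonneg (12 * angle q y₂ - d)]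
  have b2 : angle q y₂ ≤ 1.21 * d := by
    by_contra hc
    push Not at hc
    nlinarith [sq_nonneg (20 * angle q y₁ - d)]
  exact ⟨b1, b2, by linarith, by linarith⟩

lemma inner_self_fourPointGrad (hp : ‖p‖ = 1) (h : IsSphereChain d y₀ y₁ y₂ y₃) :
    ⟪p, fourPointGrad y₀ y₁ y₂ y₃ p⟫ = 0 := by
  simp only [fourPointGrad, inner_sub_right, inner_add_right, real_inner_smul_right,
    inner_sphereLog_left_self hp h.n₀, inner_sphereLog_left_self hp h.n₁,
    inner_sphereLog_left_self hp h.n₂, inner_sphereLog_left_self hp h.n₃]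
  simp

lemma inner_fourPointGrad (w : V) : ⟪fourPointGrad y₀ y₁ y₂ y₃ p, w⟫ =
    21 * ⟪sphereLog p y₁, w⟫ + 13 * ⟪sphereLog p y₂, w⟫ - ⟪sphereLog p y₀, w⟫
      - ⟪sphereLog p y₃, w⟫ := by
  simp only [fourPointGrad, inner_sub_left, inner_add_left, real_inner_smul_left]

/-- A step of length `b` along a nonzero `G` changes the energy by at most `34 * b ^ 2 - 2 * b *
‖G‖`, which is negative for small `b`. The triangle comparisons make differentiating the energy
unnecessary. -/
lemma IsFourPointMin.grad_eq_zero (hq : IsFourPointMin y₀ y₁ y₂ y₃ q)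
    (h : IsSphereChain d y₀ y₁ y₂ y₃) : fourPointGrad y₀ y₁ y₂ y₃ q = 0 := by
  obtain ⟨b1, b2, b0, b3⟩ := hq.angle_le h
  have hd := h.d_le
  have hπ := Real.pi_gt_three
  by_contra hG
  set G := fourPointGrad y₀ y₁ y₂ y₃ q with hGdef
  have hG0 : 0 < ‖G‖ := norm_pos_iff.2 hG
  have hu : ‖(‖G‖⁻¹ • G)‖ = 1 := by
    rw [norm_smul, norm_inv, norm_norm, inv_mul_cancel₀ hG0.ne']
  have hqu : ⟪q, ‖G‖⁻¹ • G⟫ = 0 := by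
    rw [real_inner_smul_right, inner_self_fourPointGrad hq.norm_eq h, mul_zero]
  -- The bound `‖G‖ / 34` lets the linear gain beat the quadratic cost; 0.1 keeps the step in the
  -- range of the comparisons.
  set b := min 0.1 (‖G‖ / 34) with hb
  have hb0 : 0 < b := lt_min (by norm_num) (by positivity)
  have hb1 : b ≤ 0.1 := min_le_left _ _
  have hb2 : b ≤ ‖G‖ / 34 := min_le_right _ _
  set r := Real.cos b • q + Real.sin b • (‖G‖⁻¹ • G) with hr
  have hrn : ‖r‖ = 1 := unit_cos_smul_add_sin_smul hq.norm_eq hu hqu b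
  have hqr : angle q r = b :=
    angle_cos_smul_add_sin_smul hq.norm_eq hu hqu hb0.le (by linarith)
  have hlog : sphereLog q r = b • (‖G‖⁻¹ • G) :=
    sphereLog_cos_smul_add_sin_smul hq.norm_eq hu hqu hb0 (by linarith)
  have hGr : ⟪G, sphereLog q r⟫ = b * ‖G‖ := by
    rw [hlog, real_inner_smul_right, real_inner_smul_right, real_inner_self_eq_norm_sq]
    field_simp
  have u1 := angle_sq_le_add_sub_inner hq.norm_eq h.n₁ hrn (by linarith)
  have u2 := angle_sq_le_add_sub_inner hq.norm_eq h.n₂ hrn (by linarith)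
  have l0 := add_sub_inner_le_angle_sq hq.norm_eq h.n₀ hrn (A := 0.9) (B := 0.1)
    (by linarith) (by linarith) (by norm_num) (by norm_num)
  have l3 := add_sub_inner_le_angle_sq hq.norm_eq h.n₃ hrn (A := 0.9) (B := 0.1)
    (by linarith) (by linarith) (by norm_num) (by norm_num)
  have e := hq.le r hrn
  rw [hGdef, inner_fourPointGrad] at hGr
  rw [fourPointEnergy, fourPointEnergy] at e
  rw [hqr] at u1 u2 l0 l3
  norm_num at l0 l3
  nlinarith [mul_pos hb0 hG0, sq_nonneg b]

/-- Strong convexity of the energy along the geodesic from `o` to `r`. -/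
lemma fourPointEnergy_add_le (h : IsSphereChain d y₀ y₁ y₂ y₃) {o r : V} (ho : ‖o‖ = 1)
    (hr : ‖r‖ = 1) (h1 : angle o y₁ ≤ 0.484) (h2 : angle o y₂ ≤ 0.484)
    (hor : angle o r ≤ 0.856) :
    fourPointEnergy y₀ y₁ y₂ y₃ o + 18 * angle o r ^ 2
      - 2 * ⟪fourPointGrad y₀ y₁ y₂ y₃ o, sphereLog o r⟫ ≤ fourPointEnergy y₀ y₁ y₂ y₃ r := by
  have hπ := Real.pi_gt_three
  have hd := h.d_le
  have h01 := h.h₀₁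
  have h23 := h.h₂₃
  have t0 := angle_le_angle_add_angle o y₁ y₀
  have t3 := angle_le_angle_add_angle o y₂ y₃
  rw [angle_comm y₁ y₀] at t0
  have u0 := angle_sq_le_add_sub_inner ho h.n₀ hr (by linarith)
  have u3 := angle_sq_le_add_sub_inner ho h.n₃ hr (by linarith)
  -- Here `0.484 = 1.21 * 0.4` and `0.856 = (0.93 + 1.21) * 0.4`. The quadratic coefficient exceeds
  -- 0.67, and `34 * 0.67 - 2 > 18`.
  have l1 := add_sub_inner_le_angle_sq ho h.n₁ hr h1 hor (by norm_num) (by norm_num)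
  have l2 := add_sub_inner_le_angle_sq ho h.n₂ hr h2 hor (by norm_num) (by norm_num)
  rw [inner_fourPointGrad, fourPointEnergy, fourPointEnergy]
  norm_num at l1 l2
  nlinarith [sq_nonneg (angle o r)]

/-- Localisation puts both minimisers close enough for strong convexity at `p`, where the gradient
term vanishes. -/
lemma IsFourPointMin.eq (hp : IsFourPointMin y₀ y₁ y₂ y₃ p) (hq : IsFourPointMin y₀ y₁ y₂ y₃ q)
    (h : IsSphereChain d y₀ y₁ y₂ y₃) : p = q := by
  obtain ⟨p1, p2, -, -⟩ := hp.angle_le h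
  obtain ⟨q1, -, -, -⟩ := hq.angle_le h
  have hd := h.d_le
  have t := angle_le_angle_add_angle p y₁ q
  rw [angle_comm y₁ q] at t
  have e := fourPointEnergy_add_le h hp.norm_eq hq.norm_eq (by linarith) (by linarith)
    (by linarith)
  rw [hp.grad_eq_zero h, inner_zero_left] at e
  have := hq.le p hp.norm_eq
  refine eq_of_angle_eq_zero_of_unit hp.norm_eq hq.norm_eq ?_
  nlinarith [angle_nonneg p q]

/-- The two points inserted near the same edge. -/
lemma IsFourPointMin.angle_reverse_le (hp : IsFourPointMin y₀ y₁ y₂ y₃ p)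
    (hq : IsFourPointMin y₃ y₂ y₁ y₀ q) (h : IsSphereChain d y₀ y₁ y₂ y₃) :
    angle p q ≤ 0.98 * d := by
  obtain ⟨p1, p2, -, -⟩ := hp.angle_le h
  obtain ⟨q1, q2, -, -⟩ := hq.angle_le h.symm
  have hπ := Real.pi_gt_three
  have hd := h.d_le
  have hd0 := h.nonneg
  have t := angle_le_angle_add_angle p y₁ q
  rw [angle_comm y₁ q] at t
  have e1 := fourPointEnergy_add_le h.symm hp.norm_eq hq.norm_eq (by linarith) (by linarith)
    (by linarith)
  have e2 := fourPointEnergy_add_le h.symm hq.norm_eq hp.norm_eq (by linarith) (by linarith)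
    (by rw [angle_comm]; linarith)
  rw [hq.grad_eq_zero h.symm, inner_zero_left, angle_comm q p] at e2
  -- Reversal only exchanges the weights 21 and 13, and the gradient of the original problem
  -- vanishes at `p`. The bound below is `17.12 = 8 * (0.93 + 1.21)`.
  have hG : fourPointGrad y₃ y₂ y₁ y₀ p = (8 : ℝ) • (sphereLog p y₂ - sphereLog p y₁) := by
    rw [← sub_zero (fourPointGrad y₃ y₂ y₁ y₀ p), ← hp.grad_eq_zero h, fourPointGrad,
      fourPointGrad]
    module
  have hn : ‖fourPointGrad y₃ y₂ y₁ y₀ p‖ ≤ 17.12 * d := by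
    rw [hG, norm_smul, Real.norm_eq_abs, abs_of_pos (by norm_num)]
    have := norm_sub_le (sphereLog p y₂) (sphereLog p y₁)
    rw [norm_sphereLog hp.norm_eq h.n₁ (by linarith),
      norm_sphereLog hp.norm_eq h.n₂ (by linarith)] at this
    linarith
  have hi := real_inner_le_norm (fourPointGrad y₃ y₂ y₁ y₀ p) (sphereLog p q)
  rw [norm_sphereLog hp.norm_eq hq.norm_eq (by linarith)] at hi
  have hi2 := mul_le_mul_of_nonneg_right hn (angle_nonneg p q)
  -- Adding `e1` and `e2` cancels the energies: with `θ = angle p q`, `36 * θ ^ 2 ≤ 2 * 17.12 * d *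
  -- θ`.
  by_contra hc
  push Not at hc
  nlinarith [angle_nonneg p q]

/-- The triangle comparisons are made from both `y₁` and `q`, so that the squared distances to `y₀`,
`y₂`, `y₃` cancel. The weight 21 then enters exactly, with no curvature loss, which the general
strong convexity constant would not achieve. -/
lemma IsFourPointMin.angle_le_half (hq : IsFourPointMin y₀ y₁ y₂ y₃ q)
    (h : IsSphereChain d y₀ y₁ y₂ y₃) : angle q y₁ ≤ 0.49 * d := by
  obtain ⟨q1, q2, q0, q3⟩ := hq.angle_le h
  have hπ := Real.pi_gt_three
  have hd := h.d_le
  have hd0 := h.nonneg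
  have h01 := h.h₀₁
  have h12 := h.h₁₂
  have h23 := h.h₂₃
  have t3 := angle_le_angle_add_angle y₁ y₂ y₃
  have h10 := h01
  rw [angle_comm] at h10
  have hyq := angle_comm y₁ q
  have n1 := h.n₁
  have nq := hq.norm_eq
  have a0 := angle_sq_le_add_sub_inner n1 h.n₀ nq (by linarith)
  have a3 := angle_sq_le_add_sub_inner n1 h.n₃ nq (by linarith)
  have a2 := add_sub_inner_le_angle_sq n1 h.n₂ nq (A := 0.4) (B := 0.372)
    (by linarith) (by linarith) (by norm_num) (by norm_num)
  have b0 := angle_sq_le_add_sub_inner nq h.n₀ n1 (by linarith)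
  have b3 := angle_sq_le_add_sub_inner nq h.n₃ n1 (by linarith)
  have b2 := add_sub_inner_le_angle_sq nq h.n₂ n1 (A := 0.484) (B := 0.372)
    (by linarith) (by linarith) (by norm_num) (by norm_num)
  have hg := inner_fourPointGrad (y₀ := y₀) (y₁ := y₁) (y₂ := y₂) (y₃ := y₃) (p := q)
    (sphereLog q y₁)
  rw [hq.grad_eq_zero h, inner_zero_left, real_inner_self_eq_norm_sq,
    norm_sphereLog nq n1 (by linarith)] at hg
  -- This is the gradient vector at `y₁`, where the term of weight 21 vanishes.
  set F := (13 : ℝ) • sphereLog y₁ y₂ - sphereLog y₁ y₀ - sphereLog y₁ y₃ with hF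
  have hFi : ⟪F, sphereLog y₁ q⟫ = 13 * ⟪sphereLog y₁ y₂, sphereLog y₁ q⟫
      - ⟪sphereLog y₁ y₀, sphereLog y₁ q⟫ - ⟪sphereLog y₁ y₃, sphereLog y₁ q⟫ := by
    simp only [hF, inner_sub_left, real_inner_smul_left]
  have hFn : ‖F‖ ≤ 14.4 * d := by
    -- Pairing `y₃` with one copy of `y₂` gives `12 + 1 + 1.4 = 14.4`. Bounding the terms separately
    -- would give 16, too large for a displacement below `d / 2`.
    have e : F = (12 : ℝ) • sphereLog y₁ y₂ - sphereLog y₁ y₀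
        - (sphereLog y₁ y₃ - sphereLog y₁ y₂) := by rw [hF]; module
    have s1 := norm_sphereLog_sub_le n1 h.n₂ h.n₃ h12 (by linarith) hd h23
    have s2 := norm_sub_le ((12 : ℝ) • sphereLog y₁ y₂ - sphereLog y₁ y₀)
      (sphereLog y₁ y₃ - sphereLog y₁ y₂)
    have s3 := norm_sub_le ((12 : ℝ) • sphereLog y₁ y₂) (sphereLog y₁ y₀)
    rw [norm_smul, norm_sphereLog n1 h.n₂ (by linarith), norm_sphereLog n1 h.n₀ (by linarith),
      Real.norm_eq_abs, abs_of_pos (by norm_num)] at s3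
    rw [e]
    linarith
  have hi := real_inner_le_norm F (sphereLog y₁ q)
  rw [norm_sphereLog n1 nq (by linarith), hyq] at hi
  have hi2 := mul_le_mul_of_nonneg_right hFn (angle_nonneg q y₁)
  rw [hyq] at a0 a3 a2
  have key : 58.96 * angle q y₁ ^ 2 ≤ 28.8 * d * angle q y₁ := by
    norm_num at a2 b2
    nlinarith [sq_nonneg (angle q y₁)]
  by_contra hc
  push Not at hc
  nlinarith [angle_nonneg q y₁]

end

/-! ### Lengths of curves on the sphere -/

section

open InnerProductGeometry
open scoped RealInnerProductSpace

variable {V : Type*} [NormedAddCommGroup V] [InnerProductSpace ℝ V]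

lemma angle_mul_le_norm_sub {o x : V} (ho : ‖o‖ = 1) (hx : ‖x‖ = 1) :
    angle o x * (1 - angle o x ^ 2 / 24) ≤ ‖x - o‖ := by
  have hθ := angle_nonneg o x
  have hs : 0 ≤ Real.sin (angle o x / 2) :=
    Real.sin_nonneg_of_nonneg_of_le_pi (by linarith) (by linarith [angle_le_pi o x])
  have e : ‖x - o‖ = 2 * Real.sin (angle o x / 2) := by
    rw [← sq_eq_sq₀ (norm_nonneg _) (by positivity), norm_sub_sq_real, real_inner_comm,
      inner_eq_cos_angle_of_unit ho hx, ho, hx, mul_pow, Real.sin_sq_eq_half_sub]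
    ring_nf
  rw [e]
  have := Real.sin_ge_sub_cube (x := angle o x / 2) (by positivity)
  nlinarith

/-- Chord and angle agree to first order, so the angle from `γ 0` grows no faster than the speed. A
one-sided slope comparison suffices, as the angle need not be differentiable. -/
lemma angle_le_integral_norm_deriv {γ : ℝ → V} (hγ : ContDiffOn ℝ 1 γ (Icc 0 1))
    (hs : ∀ t ∈ Icc (0 : ℝ) 1, ‖γ t‖ = 1) :
    angle (γ 0) (γ 1) ≤ ∫ t in (0 : ℝ)..1, ‖deriv γ t‖ := by
  set g := derivWithin γ (Icc 0 1) with hg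
  have hgc : ContinuousOn g (Icc 0 1) :=
    hγ.continuousOn_derivWithin (uniqueDiffOn_Icc zero_lt_one) le_rfl
  set G : ℝ → V := fun t => g (projIcc 0 1 zero_le_one t) with hG
  have hGc : Continuous G :=
    hgc.comp_continuous (continuous_subtype_val.comp continuous_projIcc) fun t => Subtype.coe_prop _
  have hGg : ∀ t ∈ Icc (0 : ℝ) 1, G t = g t := fun t ht => by
    simp only [hG, projIcc_of_mem zero_le_one ht]
  -- At the endpoints `deriv` depends on `γ` outside the interval, about which nothing is known;
  -- they have measure zero.
  have hint : ∫ t in (0 : ℝ)..1, ‖deriv γ t‖ = ∫ t in (0 : ℝ)..1, ‖G t‖ := by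
    rw [intervalIntegral.integral_of_le zero_le_one, intervalIntegral.integral_of_le zero_le_one,
      MeasureTheory.integral_Ioc_eq_integral_Ioo, MeasureTheory.integral_Ioc_eq_integral_Ioo]
    refine MeasureTheory.setIntegral_congr_fun measurableSet_Ioo fun t ht => ?_
    simp only [hGg t (Ioo_subset_Icc_self ht), hg,
      derivWithin_of_mem_nhds (Icc_mem_nhds ht.1 ht.2)]
  rw [hint]
  have hne : ∀ t ∈ Icc (0 : ℝ) 1, γ t ≠ 0 := fun t ht h0 => by
    have := hs t ht
    rw [h0, norm_zero] at this
    exact zero_ne_one this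
  have h0mem : (0 : ℝ) ∈ Icc (0 : ℝ) 1 := ⟨le_rfl, zero_le_one⟩
  have hang : ∀ u ∈ Icc (0 : ℝ) 1, ∀ s : Set ℝ, ∀ t ∈ Icc (0 : ℝ) 1, ContinuousWithinAt γ s t →
      ContinuousWithinAt (fun z => angle (γ u) (γ z)) s t := fun u hu s t ht hc =>
    (continuousAt_angle (x := (γ u, γ t)) (hne u hu) (hne t ht)).comp_continuousWithinAt
      (f := fun z => (γ u, γ z)) (continuousWithinAt_const.prodMk hc)
  have hB : ∀ x, HasDerivAt (fun t => ∫ s in (0 : ℝ)..t, ‖G s‖) ‖G x‖ x := fun x =>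
    (hGc.norm.integral_hasStrictDerivAt 0 x).hasDerivAt
  refine image_le_of_liminf_slope_right_le_deriv_boundary
    (f := fun t => angle (γ 0) (γ t)) (a := 0) (b := 1)
    (B := fun t => ∫ s in (0 : ℝ)..t, ‖G s‖) (B' := fun t => ‖G t‖)
    (fun t ht => hang 0 h0mem _ t ht (hγ.continuousOn t ht)) ?_
    (fun x _ => (hB x).continuousAt.continuousWithinAt)
    (fun x _ => (hB x).hasDerivWithinAt) ?_ ⟨zero_le_one, le_rfl⟩
  · simp only [intervalIntegral.integral_same]
    exact (angle_self_of_unit (hs 0 h0mem)).le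
  intro x hx r hr
  have hxI : x ∈ Icc (0 : ℝ) 1 := Ico_subset_Icc_self hx
  have hd : HasDerivWithinAt γ (g x) (Ioi x) x :=
    ((hγ.differentiableOn one_ne_zero x hxI).hasDerivWithinAt).mono_of_mem_nhdsWithin
      (Icc_mem_nhdsGT_of_mem hx)
  have hslope : Tendsto (fun z => ‖slope γ x z‖) (𝓝[>] x) (𝓝 ‖g x‖) :=
    ((hasDerivWithinAt_iff_tendsto_slope' (notMem_Ioi.2 le_rfl)).1 hd).norm
  have hθ : Tendsto (fun z => angle (γ x) (γ z)) (𝓝[>] x) (𝓝 0) := by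
    have := hang x hxI _ x hxI hd.continuousWithinAt
    rwa [ContinuousWithinAt, angle_self_of_unit (hs x hxI)] at this
  have hlim : Tendsto (fun z => r * (1 - angle (γ x) (γ z) ^ 2 / 24)) (𝓝[>] x) (𝓝 r) := by
    have := ((hθ.pow 2).div_const 24).const_sub 1 |>.const_mul r
    simpa using this
  rw [hGg x hxI] at hr
  have hmem : ∀ᶠ z in 𝓝[>] x, z ∈ Icc (0 : ℝ) 1 := Icc_mem_nhdsGT_of_mem hx
  refine Eventually.frequently ?_
  filter_upwards [hslope.eventually_lt hlim hr, hθ.eventually_lt_const one_pos, hmem,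
    self_mem_nhdsWithin] with z hz1 hz2 hz hxz
  have hxz' : 0 < z - x := sub_pos.2 hxz
  have hθ0 := angle_nonneg (γ x) (γ z)
  have hfac : 0 < 1 - angle (γ x) (γ z) ^ 2 / 24 := by nlinarith
  have h1 := angle_mul_le_norm_sub (hs x hxI) (hs z hz)
  have h2 := angle_le_angle_add_angle (γ 0) (γ x) (γ z)
  rw [slope_def_module, norm_smul, norm_inv, Real.norm_eq_abs, abs_of_pos hxz',
    inv_mul_lt_iff₀ hxz'] at hz1
  rw [slope_def_field, div_lt_iff₀ hxz']
  have h3 : angle (γ x) (γ z) < r * (z - x) := by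
    refine lt_of_mul_lt_mul_right ?_ hfac.le
    linarith
  linarith

lemma exists_unit_orthogonal_decomposition (hV : 1 < Module.finrank ℝ V) {p q : V}
    (hp : ‖p‖ = 1) (hq : ‖q‖ = 1) :
    ∃ u : V, ‖u‖ = 1 ∧ ⟪p, u⟫ = 0 ∧
      q = Real.cos (angle p q) • p + Real.sin (angle p q) • u := by
  have hw := norm_sub_smul_cos_angle hp hq
  rcases eq_or_ne (Real.sin (angle p q)) 0 with hs | hs
  -- For equal or antipodal points any orthogonal direction works; the dimension bound supplies one.
  · obtain ⟨u, hu, hpu⟩ : ∃ u : V, u ≠ 0 ∧ ⟪p, u⟫ = 0 := by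
      by_contra! hcon
      have hbot : (ℝ ∙ p)ᗮ = ⊥ := by
        rw [Submodule.eq_bot_iff]
        intro v hv
        by_contra hv0
        exact hcon v hv0 (Submodule.mem_orthogonal_singleton_iff_inner_right.1 hv)
      have : FiniteDimensional ℝ V := Module.finite_of_finrank_pos (by omega)
      have h1 := Submodule.finrank_add_finrank_orthogonal (ℝ ∙ p)
      rw [hbot, finrank_bot, finrank_span_singleton (by rintro rfl; simp at hp)] at h1
      omega
    refine ⟨‖u‖⁻¹ • u, ?_, ?_, ?_⟩
    · rw [norm_smul, norm_inv, norm_norm, inv_mul_cancel₀ (norm_ne_zero_iff.2 hu)]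
    · rw [real_inner_smul_right, hpu, mul_zero]
    · rw [hs, norm_eq_zero, sub_eq_zero] at hw
      rw [hs, zero_smul, add_zero]
      exact hw
  · refine ⟨(Real.sin (angle p q))⁻¹ • (q - Real.cos (angle p q) • p), ?_, ?_, ?_⟩
    · rw [norm_smul, hw, norm_inv, Real.norm_eq_abs, abs_of_nonneg (sin_angle_nonneg _ _),
        inv_mul_cancel₀ hs]
    · rw [real_inner_smul_right, inner_sub_right, real_inner_smul_right,
        inner_eq_cos_angle_of_unit hp hq, real_inner_self_eq_norm_sq, hp]
      ring
    · rw [smul_smul, mul_inv_cancel₀ hs, one_smul]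
      abel

end

/-! ### Riemannian distance equals angle -/

section

open InnerProductGeometry

variable {n : ℕ}

lemma UnitSphere.norm_coe (p : UnitSphere n) : ‖(p : EuclideanSpace ℝ (Fin (n + 1)))‖ = 1 :=
  norm_eq_of_mem_sphere p

theorem sphereDist_eq_angle (hn : 1 ≤ n) (p q : UnitSphere n) :
    sphereDist p q = angle (p : EuclideanSpace ℝ (Fin (n + 1))) q := by
  refine IsLeast.csInf_eq ⟨?_, ?_⟩
  · obtain ⟨u, hu, hpu, hq⟩ := exists_unit_orthogonal_decomposition
      (by rw [finrank_euclideanSpace_fin]; omega) p.norm_coe q.norm_coe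
    set θ := angle (p : EuclideanSpace ℝ (Fin (n + 1))) q with hθ
    have hd : ∀ t : ℝ, HasDerivAt
        (fun t : ℝ => Real.cos (t * θ) • (p : EuclideanSpace ℝ (Fin (n + 1))) +
          Real.sin (t * θ) • u)
        (θ • (Real.cos (t * θ + Real.pi / 2) • (p : EuclideanSpace ℝ (Fin (n + 1))) +
          Real.sin (t * θ + Real.pi / 2) • u)) t := fun t => by
      have h1 : HasDerivAt (fun t : ℝ => t * θ) θ t := by
        simpa using (hasDerivAt_id t).mul_const θ
      refine ((h1.cos.smul_const (p : EuclideanSpace ℝ (Fin (n + 1)))).add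
        (h1.sin.smul_const u)).congr_deriv ?_
      rw [Real.cos_add_pi_div_two, Real.sin_add_pi_div_two]
      module
    refine ⟨fun t => Real.cos (t * θ) • (p : EuclideanSpace ℝ (Fin (n + 1))) +
      Real.sin (t * θ) • u, ?_, fun t _ => ?_, ?_, ?_, ?_⟩
    · refine ContDiff.contDiffOn ?_
      fun_prop
    · rw [mem_sphere_zero_iff_norm]
      exact unit_cos_smul_add_sin_smul p.norm_coe hu hpu _
    · simp
    · simp only [one_mul]
      exact hq.symm
    · have : ∀ t, ‖deriv (fun t : ℝ => Real.cos (t * θ) • (p : EuclideanSpace ℝ (Fin (n + 1))) +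
          Real.sin (t * θ) • u) t‖ = θ := fun t => by
        rw [(hd t).deriv, norm_smul, unit_cos_smul_add_sin_smul p.norm_coe hu hpu, mul_one,
          Real.norm_eq_abs, abs_of_nonneg (angle_nonneg _ _)]
      simp only [this]
      simp
  · rintro L ⟨γ, hγ, hs, h0, h1, rfl⟩
    rw [← h0, ← h1]
    exact angle_le_integral_norm_deriv hγ fun t ht => mem_sphere_zero_iff_norm.1 (hs t ht)

end

/-! ### From the mask to the four-point problem; contractivity -/

section

open InnerProductGeometry

variable {n : ℕ}

lemma centerEnergy_negMask_even (hn : 1 ≤ n) (x : ℤ → UnitSphere n) (m : ℤ) (p : UnitSphere n) :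
    centerEnergy negMask x (2 * m) p =
      fourPointEnergy (x (m - 1) : EuclideanSpace ℝ (Fin (n + 1))) (x m) (x (m + 1)) (x (m + 2)) p
        / 32 := by
  have hsupp : Function.support (fun j : ℤ => negMask (2 * m - 2 * j) * sphereDist p (x j) ^ 2) ⊆
      (({m - 1, m, m + 1, m + 2} : Finset ℤ) : Set ℤ) := by
    intro j hj
    by_contra hc
    simp only [Finset.coe_insert, Finset.coe_singleton, mem_insert_iff, mem_singleton_iff,
      not_or] at hc
    refine hj ?_
    have : negMask (2 * m - 2 * j) = 0 := by
      rw [negMask, if_neg (by omega), if_neg (by omega), if_neg (by omega)]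
    simp [this]
  rw [centerEnergy, finsum_eq_sum_of_support_subset _ hsupp,
    Finset.sum_insert (by simp; omega), Finset.sum_insert (by simp), Finset.sum_insert (by simp),
    Finset.sum_singleton, fourPointEnergy]
  simp only [sphereDist_eq_angle hn]
  rw [show 2 * m - 2 * (m - 1) = 2 by ring, show 2 * m - 2 * m = 0 by ring,
    show 2 * m - 2 * (m + 1) = -2 by ring, show 2 * m - 2 * (m + 2) = -4 by ring]
  norm_num [negMask]
  ring

lemma centerEnergy_negMask_odd (hn : 1 ≤ n) (x : ℤ → UnitSphere n) (m : ℤ) (p : UnitSphere n) :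
    centerEnergy negMask x (2 * m + 1) p =
      fourPointEnergy (x (m + 2) : EuclideanSpace ℝ (Fin (n + 1))) (x (m + 1)) (x m) (x (m - 1)) p
        / 32 := by
  have hsupp : Function.support
      (fun j : ℤ => negMask (2 * m + 1 - 2 * j) * sphereDist p (x j) ^ 2) ⊆
      (({m - 1, m, m + 1, m + 2} : Finset ℤ) : Set ℤ) := by
    intro j hj
    by_contra hc
    simp only [Finset.coe_insert, Finset.coe_singleton, mem_insert_iff, mem_singleton_iff,
      not_or] at hc
    refine hj ?_
    have : negMask (2 * m + 1 - 2 * j) = 0 := by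
      rw [negMask, if_neg (by omega), if_neg (by omega), if_neg (by omega)]
    simp [this]
  rw [centerEnergy, finsum_eq_sum_of_support_subset _ hsupp,
    Finset.sum_insert (by simp; omega), Finset.sum_insert (by simp), Finset.sum_insert (by simp),
    Finset.sum_singleton, fourPointEnergy]
  simp only [sphereDist_eq_angle hn]
  rw [show 2 * m + 1 - 2 * (m - 1) = 3 by ring, show 2 * m + 1 - 2 * m = 1 by ring,
    show 2 * m + 1 - 2 * (m + 1) = -1 by ring, show 2 * m + 1 - 2 * (m + 2) = -3 by ring]
  norm_num [negMask]
  ring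

lemma isFourPointMin_iff_forall_sphere {y₀ y₁ y₂ y₃ : EuclideanSpace ℝ (Fin (n + 1))}
    {p : UnitSphere n} : IsFourPointMin y₀ y₁ y₂ y₃ (p : EuclideanSpace ℝ (Fin (n + 1))) ↔
      ∀ q : UnitSphere n, fourPointEnergy y₀ y₁ y₂ y₃ (p : EuclideanSpace ℝ (Fin (n + 1))) ≤
        fourPointEnergy y₀ y₁ y₂ y₃ (q : EuclideanSpace ℝ (Fin (n + 1))) :=
  ⟨fun h q => h.le q q.norm_coe,
    fun h => ⟨p.norm_coe, fun r hr => h ⟨r, mem_sphere_zero_iff_norm.2 hr⟩⟩⟩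

lemma isCenter_negMask_even_iff (hn : 1 ≤ n) {x : ℤ → UnitSphere n} {m : ℤ} {p : UnitSphere n} :
    IsCenter negMask x (2 * m) p ↔
      IsFourPointMin (x (m - 1) : EuclideanSpace ℝ (Fin (n + 1))) (x m) (x (m + 1)) (x (m + 2))
        p := by
  rw [isFourPointMin_iff_forall_sphere]
  refine forall_congr' fun q => ?_
  rw [centerEnergy_negMask_even hn, centerEnergy_negMask_even hn,
    div_le_div_iff_of_pos_right (by norm_num)]

lemma isCenter_negMask_odd_iff (hn : 1 ≤ n) {x : ℤ → UnitSphere n} {m : ℤ} {p : UnitSphere n} :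
    IsCenter negMask x (2 * m + 1) p ↔
      IsFourPointMin (x (m + 2) : EuclideanSpace ℝ (Fin (n + 1))) (x (m + 1)) (x m) (x (m - 1))
        p := by
  rw [isFourPointMin_iff_forall_sphere]
  refine forall_congr' fun q => ?_
  rw [centerEnergy_negMask_odd hn, centerEnergy_negMask_odd hn,
    div_le_div_iff_of_pos_right (by norm_num)]

lemma UnitSphere.coe_ne_zero (p : UnitSphere n) : (p : EuclideanSpace ℝ (Fin (n + 1))) ≠ 0 :=
  norm_ne_zero_iff.1 (by rw [p.norm_coe]; exact one_ne_zero)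

lemma exists_isFourPointMin (y₀ y₁ y₂ y₃ : UnitSphere n) :
    ∃ p : UnitSphere n, IsFourPointMin (y₀ : EuclideanSpace ℝ (Fin (n + 1))) y₁ y₂ y₃ p := by
  have hc : ∀ y : UnitSphere n, Continuous fun p : UnitSphere n =>
      angle (p : EuclideanSpace ℝ (Fin (n + 1))) y := fun y => by
    refine continuous_iff_continuousAt.2 fun p => ?_
    exact (continuousAt_angle (x := ((p : EuclideanSpace ℝ (Fin (n + 1))),
      (y : EuclideanSpace ℝ (Fin (n + 1))))) p.coe_ne_zero y.coe_ne_zero).comp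
      (f := fun p : UnitSphere n => ((p : EuclideanSpace ℝ (Fin (n + 1))),
        (y : EuclideanSpace ℝ (Fin (n + 1)))))
      (continuous_subtype_val.prodMk continuous_const).continuousAt
  obtain ⟨p, -, hp⟩ := isCompact_univ.exists_isMinOn ⟨y₀, mem_univ _⟩
    ((((((hc y₁).pow 2).const_mul 21).add (((hc y₂).pow 2).const_mul 13)).sub
      ((hc y₀).pow 2)).sub ((hc y₃).pow 2)).continuousOn
  exact ⟨p, isFourPointMin_iff_forall_sphere.2 fun q => hp (mem_univ q)⟩

lemma angle_le_maxStep (hn : 1 ≤ n) (x : ℤ → UnitSphere n) (l : ℤ) :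
    angle (x l : EuclideanSpace ℝ (Fin (n + 1))) (x (l + 1)) ≤ maxStep x := by
  rw [← sphereDist_eq_angle hn]
  refine le_ciSup (f := fun l : ℤ => sphereDist (x l) (x (l + 1))) ⟨Real.pi, ?_⟩ l
  rintro _ ⟨l, rfl⟩
  simp only [sphereDist_eq_angle hn]
  exact angle_le_pi _ _

lemma isSphereChain_of_maxStep (hn : 1 ≤ n) {x : ℤ → UnitSphere n} (hx : maxStep x < 0.4)
    (m : ℤ) : IsSphereChain (maxStep x) (x (m - 1) : EuclideanSpace ℝ (Fin (n + 1))) (x m)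
      (x (m + 1)) (x (m + 2)) where
  d_le := hx.le
  n₀ := (x _).norm_coe
  n₁ := (x _).norm_coe
  n₂ := (x _).norm_coe
  n₃ := (x _).norm_coe
  h₀₁ := by simpa using angle_le_maxStep hn x (m - 1)
  h₁₂ := angle_le_maxStep hn x m
  h₂₃ := by simpa [add_assoc] using angle_le_maxStep hn x (m + 1)

theorem existsUnique_isCenter (hn : 1 ≤ n) {x : ℤ → UnitSphere n} (hx : maxStep x < 0.4) (i : ℤ) :
    ∃! p, IsCenter negMask x i p := by
  obtain ⟨m, rfl | rfl⟩ := Int.even_or_odd' i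
  · simp only [isCenter_negMask_even_iff hn]
    obtain ⟨p, hp⟩ := exists_isFourPointMin (x (m - 1)) (x m) (x (m + 1)) (x (m + 2))
    exact ⟨p, hp, fun q hq => Subtype.ext (hq.eq hp (isSphereChain_of_maxStep hn hx m))⟩
  · simp only [isCenter_negMask_odd_iff hn]
    obtain ⟨p, hp⟩ := exists_isFourPointMin (x (m + 2)) (x (m + 1)) (x m) (x (m - 1))
    exact ⟨p, hp, fun q hq => Subtype.ext (hq.eq hp (isSphereChain_of_maxStep hn hx m).symm)⟩

lemma isCenter_riemannianAnalogue (hn : 1 ≤ n) {x : ℤ → UnitSphere n} (hx : maxStep x < 0.4)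
    (i : ℤ) : IsCenter negMask x i (riemannianAnalogue negMask x i) := by
  have h := (existsUnique_isCenter hn hx i).exists
  rw [riemannianAnalogue, dif_pos h]
  exact h.choose_spec

lemma isFourPointMin_riemannianAnalogue_even (hn : 1 ≤ n) {x : ℤ → UnitSphere n}
    (hx : maxStep x < 0.4) (m : ℤ) :
    IsFourPointMin (x (m - 1) : EuclideanSpace ℝ (Fin (n + 1))) (x m) (x (m + 1)) (x (m + 2))
      (riemannianAnalogue negMask x (2 * m)) :=
  (isCenter_negMask_even_iff hn).1 (isCenter_riemannianAnalogue hn hx _)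

lemma isFourPointMin_riemannianAnalogue_odd (hn : 1 ≤ n) {x : ℤ → UnitSphere n}
    (hx : maxStep x < 0.4) (m : ℤ) :
    IsFourPointMin (x (m + 2) : EuclideanSpace ℝ (Fin (n + 1))) (x (m + 1)) (x m) (x (m - 1))
      (riemannianAnalogue negMask x (2 * m + 1)) :=
  (isCenter_negMask_odd_iff hn).1 (isCenter_riemannianAnalogue hn hx _)

lemma angle_riemannianAnalogue_even_le (hn : 1 ≤ n) {x : ℤ → UnitSphere n}
    (hx : maxStep x < 0.4) (m : ℤ) :
    angle (riemannianAnalogue negMask x (2 * m) : EuclideanSpace ℝ (Fin (n + 1))) (x m)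
      ≤ 0.49 * maxStep x :=
  (isFourPointMin_riemannianAnalogue_even hn hx m).angle_le_half
    (isSphereChain_of_maxStep hn hx m)

/-- An even index gives the two points on one edge; an odd index gives two points around `x (m +
1)`, each displaced by at most `0.49 * maxStep x`. -/
lemma angle_riemannianAnalogue_succ_le (hn : 1 ≤ n) {x : ℤ → UnitSphere n}
    (hx : maxStep x < 0.4) (i : ℤ) :
    angle (riemannianAnalogue negMask x i : EuclideanSpace ℝ (Fin (n + 1)))
      (riemannianAnalogue negMask x (i + 1)) ≤ 0.98 * maxStep x := by
  obtain ⟨m, rfl | rfl⟩ := Int.even_or_odd' i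
  · exact (isFourPointMin_riemannianAnalogue_even hn hx m).angle_reverse_le
      (isFourPointMin_riemannianAnalogue_odd hn hx m) (isSphereChain_of_maxStep hn hx m)
  · have h1 := (isFourPointMin_riemannianAnalogue_odd hn hx m).angle_le_half
      (isSphereChain_of_maxStep hn hx m).symm
    have h2 := angle_riemannianAnalogue_even_le hn hx (m + 1)
    rw [angle_comm] at h2
    rw [show 2 * m + 1 + 1 = 2 * (m + 1) by ring]
    refine (angle_le_angle_add_angle _ (x (m + 1) : EuclideanSpace ℝ (Fin (n + 1))) _).trans ?_
    linarith

lemma maxStep_nonneg (hn : 1 ≤ n) (x : ℤ → UnitSphere n) : 0 ≤ maxStep x :=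
  (angle_nonneg _ _).trans (angle_le_maxStep hn x 0)

lemma maxStep_riemannianAnalogue_le (hn : 1 ≤ n) {x : ℤ → UnitSphere n} (hx : maxStep x < 0.4) :
    maxStep (riemannianAnalogue negMask x) ≤ 0.98 * maxStep x :=
  ciSup_le fun l => by
    rw [sphereDist_eq_angle hn]
    exact angle_riemannianAnalogue_succ_le hn hx l

lemma maxStep_iterate_le (hn : 1 ≤ n) {x : ℤ → UnitSphere n} (hx : maxStep x < 0.4) (k : ℕ) :
    maxStep ((riemannianAnalogue negMask)^[k] x) ≤ 0.98 ^ k * maxStep x ∧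
      maxStep ((riemannianAnalogue negMask)^[k] x) < 0.4 := by
  have h0 := maxStep_nonneg hn x
  induction k with
  | zero => simpa using hx
  | succ k ih =>
    rw [Function.iterate_succ_apply']
    have h1 := maxStep_riemannianAnalogue_le hn ih.2
    have h2 := maxStep_nonneg hn ((riemannianAnalogue negMask)^[k] x)
    refine ⟨?_, by linarith [ih.2]⟩
    rw [pow_succ]
    linarith [ih.1]

end

/-! ### Limits of contractive refinement processes -/

section

variable {X : Type*} [MetricSpace X]

lemma floor_two_pow_succ_mul (k : ℕ) (t : ℝ) :
    ⌊(2 : ℝ) ^ (k + 1) * t⌋ = 2 * ⌊(2 : ℝ) ^ k * t⌋ ∨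
      ⌊(2 : ℝ) ^ (k + 1) * t⌋ = 2 * ⌊(2 : ℝ) ^ k * t⌋ + 1 := by
  have e : (2 : ℝ) ^ (k + 1) * t = 2 * (2 ^ k * t) := by ring
  rw [e]
  set s := (2 : ℝ) ^ k * t
  have h1 := Int.floor_le s
  have h2 := Int.lt_floor_add_one s
  have h3 : 2 * ⌊s⌋ ≤ ⌊2 * s⌋ := Int.le_floor.2 (by push_cast; linarith)
  have h4 : ⌊2 * s⌋ < 2 * ⌊s⌋ + 2 := Int.floor_lt.2 (by push_cast; linarith)
  omega

/-- A contractive, displacement-safe refinement process has a continuous limit. -/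
lemma exists_continuous_limit [CompleteSpace X] {P : ℕ → ℤ → X} {D μ : ℝ} (hμ0 : 0 ≤ μ)
    (hμ : μ < 1) (hstep : ∀ k i, dist (P k i) (P k (i + 1)) ≤ D * μ ^ k)
    (hdisp : ∀ k i, dist (P (k + 1) (2 * i)) (P k i) ≤ D * μ ^ k) :
    ∃ c : ℝ → X, Continuous c ∧
      ∀ k t, dist (P k ⌊(2 : ℝ) ^ k * t⌋) (c t) ≤ 2 * D / (1 - μ) * μ ^ k := by
  have hD : 0 ≤ D := by simpa using dist_nonneg.trans (hstep 0 0)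
  -- The factor 2 covers an odd child index: one displacement plus one step at the finer level.
  have hdist : ∀ t k, dist (P k ⌊(2 : ℝ) ^ k * t⌋) (P (k + 1) ⌊(2 : ℝ) ^ (k + 1) * t⌋)
      ≤ 2 * D * μ ^ k := by
    intro t k
    have hk := hdisp k ⌊(2 : ℝ) ^ k * t⌋
    have hpos : 0 ≤ D * μ ^ k := by positivity
    rw [dist_comm]
    rcases floor_two_pow_succ_mul k t with h | h
    · rw [h]; linarith
    · rw [h]
      have h1 := hstep (k + 1) (2 * ⌊(2 : ℝ) ^ k * t⌋)
      have h2 : D * μ ^ (k + 1) ≤ D * μ ^ k := by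
        rw [pow_succ]; nlinarith
      rw [dist_comm] at h1
      have := dist_triangle (P (k + 1) (2 * ⌊(2 : ℝ) ^ k * t⌋ + 1))
        (P (k + 1) (2 * ⌊(2 : ℝ) ^ k * t⌋)) (P k ⌊(2 : ℝ) ^ k * t⌋)
      linarith
  choose c hc using fun t => cauchySeq_tendsto_of_complete
    (cauchySeq_of_le_geometric μ (2 * D) hμ (hdist t))
  have hbound : ∀ k t, dist (P k ⌊(2 : ℝ) ^ k * t⌋) (c t) ≤ 2 * D / (1 - μ) * μ ^ k := by
    intro k t
    have := dist_le_of_le_geometric_of_tendsto μ (2 * D) hμ (hdist t) (hc t) k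
    rwa [mul_div_right_comm] at this
  refine ⟨c, Metric.continuous_iff.2 fun s ε hε => ?_, hbound⟩
  have hlim : Tendsto (fun k : ℕ => (2 * (2 * D / (1 - μ)) + D) * μ ^ k) atTop (𝓝 0) := by
    simpa using (tendsto_pow_atTop_nhds_zero_of_lt_one hμ0 hμ).const_mul
      (2 * (2 * D / (1 - μ)) + D)
  obtain ⟨k, hk⟩ := (hlim.eventually_lt_const hε).exists
  refine ⟨1 / 2 ^ k, by positivity, fun t ht => ?_⟩
  have hst : |(2 : ℝ) ^ k * t - 2 ^ k * s| < 1 := by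
    rw [← mul_sub, abs_mul, abs_of_pos (by positivity), mul_comm, ← lt_div_iff₀ (by positivity)]
    exact ht
  have hfl : dist (P k ⌊(2 : ℝ) ^ k * t⌋) (P k ⌊(2 : ℝ) ^ k * s⌋) ≤ D * μ ^ k := by
    obtain ⟨ha, hb⟩ := abs_lt.1 hst
    set u := (2 : ℝ) ^ k * t
    set v := (2 : ℝ) ^ k * s
    have h1 : ⌊u⌋ < ⌊v⌋ + 2 :=
      Int.floor_lt.2 (by push_cast; linarith [Int.lt_floor_add_one v])
    have h2 : ⌊v⌋ < ⌊u⌋ + 2 :=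
      Int.floor_lt.2 (by push_cast; linarith [Int.lt_floor_add_one u])
    have : ⌊u⌋ = ⌊v⌋ ∨ ⌊u⌋ = ⌊v⌋ + 1 ∨ ⌊v⌋ = ⌊u⌋ + 1 := by omega
    rcases this with h | h | h
    · rw [h, dist_self]; positivity
    · rw [h, dist_comm]; exact hstep _ _
    · rw [h]; exact hstep _ _
  have h1 := hbound k t
  have h2 := hbound k s
  rw [dist_comm] at h1
  have := dist_triangle4 (c t) (P k ⌊(2 : ℝ) ^ k * t⌋) (P k ⌊(2 : ℝ) ^ k * s⌋) (c s)
  linarith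

end

/-! ### Convergence in charts and the main theorem -/

lemma dist_dyadicInterp_lt {E : Type*} [NormedAddCommGroup E] [NormedSpace ℝ E] {k : ℕ} {y : ℤ → E}
    {t : ℝ} {z : E} {ε : ℝ} (h1 : dist (y ⌊(2 : ℝ) ^ k * t⌋) z < ε)
    (h2 : dist (y (⌊(2 : ℝ) ^ k * t⌋ + 1)) z < ε) : dist (dyadicInterp k y t) z < ε := by
  have hf := Int.fract_nonneg ((2 : ℝ) ^ k * t)
  have hf' := (Int.fract_lt_one ((2 : ℝ) ^ k * t)).le
  exact (convex_ball z ε) (Metric.mem_ball.2 h1) (Metric.mem_ball.2 h2) (sub_nonneg.2 hf') hf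
    (by ring)

/-- Compactness of `c '' K` gives a thickening inside the chart domain and a modulus of continuity
of `φ` uniform over its points. Balls being convex, interpolation preserves the estimate. -/
lemma convergesToCurve_of_dist_le {n : ℕ} {P : ℕ → ℤ → UnitSphere n} {c : ℝ → UnitSphere n}
    (hcont : Continuous c) {η : ℕ → ℝ} (hη : Tendsto η atTop (𝓝 0))
    (h1 : ∀ k t, dist (P k ⌊(2 : ℝ) ^ k * t⌋) (c t) ≤ η k)
    (h2 : ∀ k t, dist (P k (⌊(2 : ℝ) ^ k * t⌋ + 1)) (c t) ≤ η k) : ConvergesToCurve P c := by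
  intro φ K hK hcK
  have hcK' : IsCompact (c '' K) := hK.image hcont
  constructor
  · obtain ⟨δ, hδ, hsub⟩ := hcK'.exists_thickening_subset_open φ.open_source hcK.image_subset
    filter_upwards [hη.eventually_lt_const hδ] with k hk t ht
    exact ⟨hsub (Metric.mem_thickening_iff.2 ⟨c t, mem_image_of_mem c ht, (h1 k t).trans_lt hk⟩),
      hsub (Metric.mem_thickening_iff.2 ⟨c t, mem_image_of_mem c ht, (h2 k t).trans_lt hk⟩)⟩
  · rw [Metric.tendstoUniformlyOn_iff]
    intro ε hε
    have hu := hcK'.uniformContinuousAt_of_continuousAt φ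
      (by rintro _ ⟨t, ht, rfl⟩; exact φ.continuousAt (hcK ht)) (Metric.dist_mem_uniformity hε)
    obtain ⟨δ, hδ, hsub⟩ := Metric.mem_uniformity_dist.1 hu
    filter_upwards [hη.eventually_lt_const hδ] with k hk t ht
    have key : ∀ z, dist z (c t) ≤ η k → dist (φ z) (φ (c t)) < ε := fun z hz => by
      rw [dist_comm] at hz ⊢
      exact hsub (hz.trans_lt hk) (mem_image_of_mem c ht)
    rw [dist_comm]
    exact dist_dyadicInterp_lt (key _ (h1 k t)) (key _ (h2 k t))

lemma UnitSphere.dist_le_angle {n : ℕ} (p q : UnitSphere n) :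
    dist p q ≤ InnerProductGeometry.angle (p : EuclideanSpace ℝ (Fin (n + 1))) q := by
  rw [Subtype.dist_eq, dist_eq_norm]
  exact norm_sub_le_angle p.norm_coe q.norm_coe

theorem mainTheorem3 :
    ∃ μ : ℝ, 0 < μ ∧ μ < 1 ∧ ∃ C : ℝ, 0 < C ∧
      ∀ n : ℕ, 2 ≤ n → ∀ x : ℤ → UnitSphere n, maxStep x < 0.4 →
        -- all refined points are well defined, as unique minimisers
        (∀ (k : ℕ) (i : ℤ), ∃! p : UnitSphere n,
          IsCenter negMask ((riemannianAnalogue negMask)^[k] x) i p) ∧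
        -- contractivity factor `μ`
        (∀ (k : ℕ) (i : ℤ),
          sphereDist ((riemannianAnalogue negMask)^[k] x (i + 1))
            ((riemannianAnalogue negMask)^[k] x i) ≤ μ ^ k * maxStep x) ∧
        -- displacement-safe
        (∀ i : ℤ, sphereDist (riemannianAnalogue negMask x (2 * i)) (x i) ≤ C * maxStep x) ∧
        -- convergence to a continuous limit curve
        (∃ c : ℝ → UnitSphere n, Continuous c ∧
          ConvergesToCurve (fun k => (riemannianAnalogue negMask)^[k] x) c) := by
  refine ⟨0.98, by norm_num, by norm_num, 0.49, by norm_num, fun n hn2 x hx => ?_⟩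
  have hn : 1 ≤ n := by omega
  have hk := maxStep_iterate_le hn hx
  have hM := maxStep_nonneg hn x
  have hstep : ∀ k i, dist ((riemannianAnalogue negMask)^[k] x i)
      ((riemannianAnalogue negMask)^[k] x (i + 1)) ≤ maxStep x * 0.98 ^ k := fun k i => by
    rw [mul_comm]
    exact (UnitSphere.dist_le_angle _ _).trans ((angle_le_maxStep hn _ i).trans (hk k).1)
  refine ⟨fun k i => existsUnique_isCenter hn (hk k).2 i, fun k i => ?_, fun i => ?_, ?_⟩
  · rw [sphereDist_eq_angle hn, InnerProductGeometry.angle_comm]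
    exact (angle_le_maxStep hn _ i).trans (hk k).1
  · rw [sphereDist_eq_angle hn]
    exact angle_riemannianAnalogue_even_le hn hx i
  · obtain ⟨c, hc, hb⟩ := exists_continuous_limit
      (P := fun k => (riemannianAnalogue negMask)^[k] x) (D := maxStep x) (μ := 0.98)
      (by norm_num) (by norm_num) hstep (fun k i => by
        simp only [Function.iterate_succ_apply']
        refine (UnitSphere.dist_le_angle _ _).trans
          ((angle_riemannianAnalogue_even_le hn (hk k).2 i).trans ?_)
        have := maxStep_nonneg hn ((riemannianAnalogue negMask)^[k] x)
        linarith [(hk k).1])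
    refine ⟨c, hc, convergesToCurve_of_dist_le hc
      (η := fun k => (2 * maxStep x / (1 - 0.98) + maxStep x) * 0.98 ^ k) ?_ (fun k t => ?_)
      fun k t => ?_⟩
    · simpa using (tendsto_pow_atTop_nhds_zero_of_lt_one (r := (0.98 : ℝ)) (by norm_num)
        (by norm_num)).const_mul (2 * maxStep x / (1 - 0.98) + maxStep x)
    · have h0 : 0 ≤ maxStep x * 0.98 ^ k := by positivity
      linarith [hb k t]
    · have h0 := hstep k ⌊(2 : ℝ) ^ k * t⌋
      rw [dist_comm] at h0
      have := dist_triangle ((riemannianAnalogue negMask)^[k] x (⌊(2 : ℝ) ^ k * t⌋ + 1))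
        ((riemannianAnalogue negMask)^[k] x ⌊(2 : ℝ) ^ k * t⌋) (c t)
      linarith [hb k t]
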